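/- Let $\mathcal H=\mathbb C^d$ be a finite-dimensional complex Hilbert space, let $\mathcal X$ be a finite set, and for each $x\in\mathcal X$ let $\rho_x$ be a density operator on $\mathcal H$ (that is, $\rho_x=\rho_x^*\ge 0$ and $\mathrm{Tr}[\rho_x]=1$). Let $p$ be a probability distribution on $\mathcal X$, put $\sigma=\sum_{x\in\mathcal X}p(x)\rho_x$, and let $$I(p)=H(\sigma)-\sum_{x\in\mathcal X}p(x)H(\rho_x),\qquad H(\rho)=-\mathrm{Tr}[\rho\log\rho],$$ be the quantum mutual information. For $x^n=(x_1,\dots,x_n)\in\mathcal X^n$ write $p^n(x^n)=p(x_1)\cdots p(x_n)$ and $\rho_{x^n}=\rho_{x_1}\otimes\cdots\otimes\rho_{x_n}$. For a Hermitian operator $A=\sum_i a_iE_i$, where the $a_i$ are the distinct eigenvalues of $A$ and the $E_i$ are the corresponding spectral projections, write $\{A\le 0\}=\sum_{i:\,a_i\le 0}E_i$, and let $\mathcal E_A(B)=\sum_i E_iBE_i$ be the pinching of an operator $B$ by $A$, i.e. the projection of $B$, orthogonal for the Hilbert–Schmidt inner product $\langle B,C\rangle=\mathrm{Tr}[B^*C]$,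 onto the algebra of operators commuting with $A$. Put $\overline\rho_{x^n}=\mathcal E_{\sigma^{\otimes n}}(\rho_{x^n})$. Then for every real number $a<I(p)$, $$\lim_{n\to\infty}\ \sum_{x^n\in\mathcal X^n}p^n(x^n)\,\mathrm{Tr}\Bigl[\overline\rho_{x^n}\,\bigl\{\overline\rho_{x^n}-e^{na}\sigma^{\otimes n}\le 0\bigr\}\Bigr]=0 .$$ -/

import Mathlib

open Filter Topology
open scoped ComplexOrder

noncomputable section

namespace QChannel

/-- `ρ` is a density operator on `ℂ^d`: `ρ = ρ* ≥ 0` and `Tr ρ = 1`. -/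
structure IsDensity {d : Type*} [Fintype d] (ρ : Matrix d d ℂ) : Prop where
  posSemidef : ρ.PosSemidef
  trace_eq_one : ρ.trace = 1

/-- The von Neumann entropy `H(ρ) = - Tr[ρ log ρ]`, with `log` taken by functional calculus
(as `Real.log 0 = 0`, the convention `0 log 0 = 0` is respected). -/
def entropy {d : Type*} [Fintype d] [DecidableEq d] (ρ : Matrix d d ℂ) : ℝ :=
  -((ρ * cfc Real.log ρ).trace).re

/-- The mixture state `σ_p = ∑ x, p(x) ρ_x`. -/
def mixture {X d : Type*} [Fintype X] (p : X → ℝ) (ρ : X → Matrix d d ℂ) : Matrix d d ℂ :=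
  ∑ x, p x • ρ x

/-- The quantum mutual information `I(p) = H(σ_p) - ∑ x, p(x) H(ρ_x)`. -/
def mutualInfo {X d : Type*} [Fintype X] [Fintype d] [DecidableEq d]
    (p : X → ℝ) (ρ : X → Matrix d d ℂ) : ℝ :=
  entropy (mixture p ρ) - ∑ x, p x * entropy (ρ x)

/-- The tensor product `A₁ ⊗ ⋯ ⊗ Aₙ` as an operator on `(ℂ^d)^{⊗ n}`, written in the product
basis `e_{i₁} ⊗ ⋯ ⊗ e_{iₙ}`, which is indexed by `i : Fin n → d`. -/
def tensorProd {d : Type*} {n : ℕ} (A : Fin n → Matrix d d ℂ) :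
    Matrix (Fin n → d) (Fin n → d) ℂ :=
  Matrix.of fun i j => ∏ k, A k (i k) (j k)

/-- The tensor power `A^{⊗ n}`. -/
def tensorPow {d : Type*} (n : ℕ) (A : Matrix d d ℂ) : Matrix (Fin n → d) (Fin n → d) ℂ :=
  tensorProd fun _ : Fin n => A

section Spectral

variable {m : Type*} [Fintype m] [DecidableEq m]

/-- The finite set of (distinct) eigenvalues of a Hermitian matrix. -/
def eigs (A : Matrix m m ℂ) : Finset ℝ := (A.finite_real_spectrum).toFinset

/-- The spectral projection `E_a` of the Hermitian matrix `A` for the eigenvalue `a`. -/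
def eigProj (A : Matrix m m ℂ) (a : ℝ) : Matrix m m ℂ :=
  cfc (fun t : ℝ => if t = a then (1 : ℝ) else 0) A

/-- The projection `{A ≤ 0} = ∑_{i : a_i ≤ 0} E_i` for a Hermitian `A = ∑ i, a_i E_i`. -/
def projNonpos (A : Matrix m m ℂ) : Matrix m m ℂ :=
  ∑ a ∈ (eigs A).filter (fun a => a ≤ 0), eigProj A a

/-- The pinching `ℰ_A(B) = ∑ i, E_i B E_i` by a Hermitian `A = ∑ i, a_i E_i`. The facts
`commute_pinching` and `trace_pinching` below say that it is the orthogonal projection of `B`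
onto the commutant of `A` for the Hilbert-Schmidt inner product. -/
def pinching (A B : Matrix m m ℂ) : Matrix m m ℂ :=
  ∑ a ∈ eigs A, eigProj A a * B * eigProj A a

theorem continuousOn_eigs (A : Matrix m m ℂ) (f : ℝ → ℝ) : ContinuousOn f (spectrum ℝ A) :=
  (A.finite_real_spectrum).continuousOn f

theorem eigProj_mul_self (A : Matrix m m ℂ) (a : ℝ) :
    eigProj A a * eigProj A a = eigProj A a := by
  unfold eigProj
  rw [← cfc_mul _ _ A (continuousOn_eigs A _) (continuousOn_eigs A _)]
  congr 1
  funext t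
  split_ifs <;> simp

theorem mul_eigProj {A : Matrix m m ℂ} (hA : A.IsHermitian) (a : ℝ) :
    A * eigProj A a = a • eigProj A a := by
  have hA' : IsSelfAdjoint A := hA
  unfold eigProj
  nth_rewrite 1 [← cfc_id ℝ A hA']
  rw [← cfc_mul _ _ A (continuousOn_eigs A _) (continuousOn_eigs A _),
    ← cfc_smul _ _ A (continuousOn_eigs A _)]
  congr 1
  funext t
  by_cases h : t = a <;> simp [h]

theorem sum_eigProj {A : Matrix m m ℂ} (hA : A.IsHermitian) :
    ∑ a ∈ eigs A, eigProj A a = 1 := by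
  have hA' : IsSelfAdjoint A := hA
  unfold eigProj
  rw [← cfc_sum _ A _ (fun _ _ => continuousOn_eigs A _), ← cfc_one ℝ A hA']
  refine cfc_congr fun t ht => ?_
  have ht' : t ∈ eigs A := by simpa [eigs] using ht
  simp [Finset.sum_apply, ht']

theorem commute_eigProj {A C : Matrix m m ℂ} (hA : A.IsHermitian) (h : Commute A C) (a : ℝ) :
    Commute (eigProj A a) C :=
  (IsSelfAdjoint.commute_cfc hA h _)

theorem commute_pinching {A : Matrix m m ℂ} (hA : A.IsHermitian) (B : Matrix m m ℂ) :
    Commute A (pinching A B) := by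
  unfold pinching
  refine Commute.sum_right _ _ _ fun a _ => ?_
  have h1 := mul_eigProj hA a
  have h2 : eigProj A a * A = a • eigProj A a :=
    ((commute_eigProj hA (Commute.refl A) a).eq).trans h1
  change _ * _ = _ * _
  rw [mul_assoc _ _ A, h2, ← mul_assoc, ← mul_assoc, h1]
  simp

theorem trace_pinching {A : Matrix m m ℂ} (hA : A.IsHermitian) (B : Matrix m m ℂ)
    {C : Matrix m m ℂ} (h : Commute A C) :
    (B.conjTranspose * C).trace = ((pinching A B).conjTranspose * C).trace := by
  have hs : ∀ a, (eigProj A a).conjTranspose = eigProj A a := fun a =>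
    cfc_predicate (R := ℝ) (fun t : ℝ => if t = a then (1 : ℝ) else 0) A
  unfold pinching
  rw [Matrix.conjTranspose_sum, Finset.sum_mul, Matrix.trace_sum]
  have key : ∀ a, ((eigProj A a * B * eigProj A a).conjTranspose * C).trace
      = (B.conjTranspose * C * eigProj A a).trace := by
    intro a
    have hc := (commute_eigProj hA h a).eq
    rw [Matrix.conjTranspose_mul, Matrix.conjTranspose_mul, hs, mul_assoc, Matrix.trace_mul_comm]
    simp only [mul_assoc]
    rw [← mul_assoc (eigProj A a) C, hc, mul_assoc, eigProj_mul_self]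
  simp only [key]
  rw [← Matrix.trace_sum, ← Finset.mul_sum, sum_eigProj hA, mul_one]

end Spectral

end QChannel

end

/-!
The proof combines typical subspaces with the Neyman–Pearson lemma. Write `S = σ^{⊗ n}` and
`R = ρ_{x^n}`. The projection `{ℰ_S(R) - e^{na} S ≤ 0}` is the optimal test for the weighted error
`Tr[ℰ_S(R) T] + e^{na} Tr[S (1 - T)]`, so its error is bounded by that of any other projection
(`IsStarProjection.trace_mul_le_projNonpos`). For a competitor which commutes with `S` the pinching
may be dropped (`trace_pinching_mul`).

The competitor is `1 - Q` with `Q = {S ≤ μ} P`. Here `P` is the support projection of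
`ℰ_S({R ≥ θ})`: it commutes with `S`, it dominates the typical projection `{R ≥ θ}`
(`mul_supportProj_pinching`), and its rank is at most the number of eigenvalues of `S`
times that of `{R ≥ θ}` (`rank_pinching_le`).
For `μ = e^{-nc}` and `θ = e^{-nc'}` this gives `e^{na} Tr[S Q] ≤ v(n) e^{n(a - c + c')}`, where
`v(n)`, the number of distinct eigenvalues of `σ^{⊗ n}`, is polynomial in `n`
(`card_eigs_tensorPow_le`). The one-shot bound is `trace_pinching_mul_projNonpos_le`.

As `a < I(p)`, there are a `c` slightly below `H(σ)` and a `c'` slightly above `∑ x, p(x) H(ρ_x)`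
for which `a - c + c' < 0`. The remaining errors, the weights of `σ^{⊗ n}` and of `ρ_{x^n}` outside
their typical subspaces, are tail probabilities of sums of independent variables once everything is
written in product eigenbases, and vanish by a Chernoff bound (`tendsto_sum_large_deviation`). No
invertibility of the states is needed, because no negative powers of them occur.
-/

namespace QChannel

/-! ### Functional calculus in an orthonormal eigenbasis -/

section Calculus

variable {m : Type*} [Fintype m] [DecidableEq m]

theorem aeval_conj_diagonal {W : Matrix m m ℂ} (hW : W.conjTranspose * W = 1) (l : m → ℝ)
    (q : Polynomial ℝ) :
    Polynomial.aeval (W * Matrix.diagonal (fun i => (l i : ℂ)) * W.conjTranspose) q =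
      W * Matrix.diagonal (fun i => ((q.eval (l i) : ℝ) : ℂ)) * W.conjTranspose := by
  have hW' : W * W.conjTranspose = 1 := mul_eq_one_comm.mp hW
  induction q using Polynomial.induction_on with
  | C r =>
    have h : Matrix.diagonal (fun _ : m => ((r : ℝ) : ℂ)) = algebraMap ℝ (Matrix m m ℂ) r := by
      rw [Matrix.algebraMap_eq_diagonal]; rfl
    simp only [Polynomial.aeval_C, Polynomial.eval_C]
    rw [h, ← Algebra.commutes, mul_assoc, hW', mul_one]
  | add p q hp hq =>
    simp only [map_add, hp, hq, Polynomial.eval_add, Complex.ofReal_add]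
    rw [← Matrix.diagonal_add, mul_add, add_mul]
  | monomial n r h =>
    rw [pow_succ, ← mul_assoc, map_mul, h, Polynomial.aeval_X]
    have : ∀ D D' : Matrix m m ℂ, W * D * W.conjTranspose * (W * D' * W.conjTranspose)
        = W * (D * D') * W.conjTranspose := by
      intro D D'
      calc _ = W * D * (W.conjTranspose * W) * D' * W.conjTranspose := by
            simp only [mul_assoc]
        _ = _ := by rw [hW]; simp only [mul_assoc, mul_one]
    rw [this, Matrix.diagonal_mul_diagonal]
    simp [mul_assoc]

theorem isHermitian_conj_diagonal (W : Matrix m m ℂ) (l : m → ℝ) :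
    (W * Matrix.diagonal (fun i => (l i : ℂ)) * W.conjTranspose).IsHermitian := by
  apply Matrix.isHermitian_mul_mul_conjTranspose
  rw [Matrix.isHermitian_diagonal_iff]
  intro i
  simp [isSelfAdjoint_iff]

/-- The functional calculus can be evaluated in any orthonormal eigenbasis. -/
theorem cfc_conj_diagonal {W : Matrix m m ℂ} (hW : W.conjTranspose * W = 1) (l : m → ℝ)
    (g : ℝ → ℝ) :
    cfc g (W * Matrix.diagonal (fun i => (l i : ℂ)) * W.conjTranspose) =
      W * Matrix.diagonal (fun i => (g (l i) : ℂ)) * W.conjTranspose := by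
  set A := W * Matrix.diagonal (fun i => (l i : ℂ)) * W.conjTranspose with hA
  have hAs : IsSelfAdjoint A := isHermitian_conj_diagonal W l
  -- On the finite set of all values involved, `g` agrees with a polynomial.
  let s : Finset ℝ := eigs A ∪ Finset.univ.image l
  let q : Polynomial ℝ := Lagrange.interpolate s id g
  have hq : ∀ t ∈ s, q.eval t = g t := fun t ht =>
    Lagrange.eval_interpolate_at_node g (Set.injOn_id _) ht
  have h1 : cfc g A = cfc q.eval A := by
    refine cfc_congr fun t ht => (hq t ?_).symm
    exact Finset.mem_union_left _ (by simpa [eigs] using ht)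
  rw [h1, cfc_polynomial q A, hA, aeval_conj_diagonal hW]
  congr 3
  funext i
  rw [hq _ (Finset.mem_union_right _ (Finset.mem_image_of_mem _ (Finset.mem_univ i)))]

theorem exists_conj_diagonal {A : Matrix m m ℂ} (hA : A.IsHermitian) :
    ∃ W : Matrix m m ℂ, W.conjTranspose * W = 1 ∧
      A = W * Matrix.diagonal (fun i => (hA.eigenvalues i : ℂ)) * W.conjTranspose :=
  ⟨hA.eigenvectorUnitary, Unitary.coe_star_mul_self _, hA.spectral_theorem⟩

theorem trace_conj_diagonal {W : Matrix m m ℂ} (hW : W.conjTranspose * W = 1) (v : m → ℂ) :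
    (W * Matrix.diagonal v * W.conjTranspose).trace = ∑ i, v i := by
  rw [Matrix.trace_mul_comm, ← mul_assoc, hW, one_mul, Matrix.trace_diagonal]

theorem trace_cfc_conj_diagonal {W : Matrix m m ℂ} (hW : W.conjTranspose * W = 1) (l : m → ℝ)
    (g : ℝ → ℝ) :
    (cfc g (W * Matrix.diagonal (fun i => (l i : ℂ)) * W.conjTranspose)).trace.re =
      ∑ i, g (l i) := by
  rw [cfc_conj_diagonal hW, trace_conj_diagonal hW, Complex.re_sum]
  simp

theorem rank_cfc {A : Matrix m m ℂ} (hA : A.IsHermitian) (g : ℝ → ℝ) :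
    ((cfc g A).rank : ℝ) = (cfc (fun t => if g t = 0 then (0 : ℝ) else 1) A).trace.re := by
  obtain ⟨W, hW, h⟩ := exists_conj_diagonal hA
  have hW' : W * W.conjTranspose = 1 := mul_eq_one_comm.mp hW
  have e : ∀ f : ℝ → ℝ, cfc f A =
      W * Matrix.diagonal (fun i => (f (hA.eigenvalues i) : ℂ)) * W.conjTranspose := fun f => by
    conv_lhs => rw [h]
    exact cfc_conj_diagonal hW _ f
  rw [e, e, trace_conj_diagonal hW,
    Matrix.rank_mul_eq_left_of_isUnit_det _ _
      ((Matrix.isUnit_iff_isUnit_det _).mp (IsUnit.of_mul_eq_one _ hW)),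
    Matrix.rank_mul_eq_right_of_isUnit_det _ _
      ((Matrix.isUnit_iff_isUnit_det _).mp (IsUnit.of_mul_eq_one _ hW')), Matrix.rank_diagonal]
  simp [Fintype.card_subtype, Finset.sum_ite]

theorem posSemidef_cfc {A : Matrix m m ℂ} {g : ℝ → ℝ} (hg : ∀ t ∈ spectrum ℝ A, 0 ≤ g t) :
    (cfc g A).PosSemidef := by
  open scoped MatrixOrder in
  exact Matrix.nonneg_iff_posSemidef.mp (cfc_nonneg hg)

theorem isHermitian_cfc (A : Matrix m m ℂ) (g : ℝ → ℝ) : (cfc g A).IsHermitian :=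
  cfc_predicate (R := ℝ) g A

theorem cfc_mul_cfc (A : Matrix m m ℂ) (f g : ℝ → ℝ) :
    cfc f A * cfc g A = cfc (fun t => f t * g t) A :=
  (cfc_mul _ _ A (continuousOn_eigs A _) (continuousOn_eigs A _)).symm

theorem spectrum_nonneg {A : Matrix m m ℂ} (hA : A.PosSemidef) {t : ℝ} (ht : t ∈ spectrum ℝ A) :
    0 ≤ t := by
  rw [hA.1.spectrum_real_eq_range_eigenvalues] at ht
  obtain ⟨i, rfl⟩ := ht
  exact hA.eigenvalues_nonneg i

theorem projNonpos_eq_cfc (A : Matrix m m ℂ) :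
    projNonpos A = cfc (fun t : ℝ => if t ≤ 0 then (1 : ℝ) else 0) A := by
  unfold projNonpos eigProj
  rw [← cfc_sum _ A _ (fun _ _ => continuousOn_eigs A _)]
  refine cfc_congr fun t ht => ?_
  have ht' : t ∈ eigs A := by simpa [eigs] using ht
  simp [Finset.sum_apply, ht']

end Calculus

/-! ### Traces against projections and the Neyman–Pearson lemma -/

section Projections

variable {m : Type*} [Fintype m] [DecidableEq m]

omit [DecidableEq m] in
theorem _root_.IsStarProjection.conjTranspose_eq {Q : Matrix m m ℂ} (h : IsStarProjection Q) :
    Q.conjTranspose = Q :=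
  h.isSelfAdjoint

theorem isStarProjection_cfc (A : Matrix m m ℂ) (s : ℝ → Prop) [DecidablePred s] :
    IsStarProjection (cfc (fun t => if s t then (1 : ℝ) else 0) A) := by
  refine ⟨?_, isHermitian_cfc A _⟩
  rw [IsIdempotentElem, cfc_mul_cfc]
  congr 1
  funext t
  split_ifs <;> simp

omit [DecidableEq m] in
theorem _root_.IsStarProjection.trace_mul_nonneg {A Q : Matrix m m ℂ}
    (hQ : IsStarProjection Q) (hA : A.PosSemidef) :
    0 ≤ (A * Q).trace.re := by
  have h : (A * Q).trace = (Q.conjTranspose * A * Q).trace := by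
    rw [hQ.conjTranspose_eq, Matrix.trace_mul_comm (Q * A) Q, ← mul_assoc, hQ.isIdempotentElem.eq,
      Matrix.trace_mul_comm]
  rw [h]
  exact (Complex.nonneg_iff.mp (hA.conjTranspose_mul_mul_same Q).trace_nonneg).1

theorem _root_.IsStarProjection.trace_mul_le {A Q : Matrix m m ℂ}
    (hQ : IsStarProjection Q) (hA : A.PosSemidef) :
    (A * Q).trace.re ≤ A.trace.re := by
  have := hQ.one_sub.trace_mul_nonneg hA
  rw [mul_sub, mul_one, Matrix.trace_sub, Complex.sub_re] at this
  linarith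

/-- The Neyman–Pearson lemma: among all projections, `{A > 0}` maximises `Tr[A Q]`. -/
theorem _root_.IsStarProjection.trace_mul_le_projNonpos {A Q : Matrix m m ℂ}
    (hQ : IsStarProjection Q) (hA : A.IsHermitian) :
    (A * Q).trace.re ≤ (A * (1 - projNonpos A)).trace.re := by
  have hA' : IsSelfAdjoint A := hA
  have hpos : (cfc (fun t : ℝ => max t 0) A).PosSemidef :=
    posSemidef_cfc fun _ _ => le_max_right _ _
  have hneg : (cfc (fun t : ℝ => max (-t) 0) A).PosSemidef :=
    posSemidef_cfc fun _ _ => le_max_right _ _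
  -- `A (1 - {A ≤ 0})` is the positive part `A₊`, and `Tr[A Q] ≤ Tr[A₊ Q] ≤ Tr[A₊]`.
  have h1 : A * (1 - projNonpos A) = cfc (fun t : ℝ => max t 0) A := by
    rw [projNonpos_eq_cfc, ← cfc_one ℝ A hA',
      ← cfc_sub _ _ A (continuousOn_eigs A _) (continuousOn_eigs A _)]
    nth_rewrite 1 [← cfc_id ℝ A hA']
    rw [cfc_mul_cfc]
    congr 1
    funext t
    by_cases h : t ≤ 0
    · simp [h]
    · simp [h, le_of_not_ge h]
  have h2 : A = cfc (fun t : ℝ => max t 0) A - cfc (fun t : ℝ => max (-t) 0) A := by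
    rw [← cfc_sub _ _ A (continuousOn_eigs A _) (continuousOn_eigs A _)]
    nth_rewrite 1 [← cfc_id ℝ A hA']
    congr 1
    funext t
    rcases le_total t 0 with h | h
    · simp [h]
    · simp [h]
  have h3 := hQ.trace_mul_nonneg hneg
  have h4 := hQ.trace_mul_le hpos
  rw [h1]
  nth_rewrite 1 [h2]
  rw [sub_mul, Matrix.trace_sub, Complex.sub_re]
  linarith

end Projections

/-! ### Pinching and supports -/

section Pinching

variable {m : Type*} [Fintype m] [DecidableEq m]

theorem isStarProjection_eigProj (A : Matrix m m ℂ) (a : ℝ) : IsStarProjection (eigProj A a) :=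
  isStarProjection_cfc A _

theorem posSemidef_pinching (A : Matrix m m ℂ) {B : Matrix m m ℂ} (hB : B.PosSemidef) :
    (pinching A B).PosSemidef := by
  refine Matrix.posSemidef_sum _ fun a _ => ?_
  have := hB.conjTranspose_mul_mul_same (eigProj A a)
  rwa [(isStarProjection_eigProj A a).conjTranspose_eq] at this

/-- Operators commuting with `A` have the same expectation in `B` and in the pinched `B`. -/
theorem trace_pinching_mul {A B C : Matrix m m ℂ} (hA : A.IsHermitian) (hB : B.PosSemidef)
    (h : Commute A C) : (pinching A B * C).trace = (B * C).trace := by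
  have := trace_pinching hA B h
  rw [hB.1.eq, (posSemidef_pinching A hB).1.eq] at this
  exact this.symm

omit [DecidableEq m] in
theorem rank_add_le (A B : Matrix m m ℂ) : (A + B).rank ≤ A.rank + B.rank := by
  unfold Matrix.rank
  rw [Matrix.mulVecLin_add]
  exact (Submodule.finrank_mono (LinearMap.range_add_le _ _)).trans
    (Submodule.finrank_add_le_finrank_add_finrank _ _)

theorem rank_pinching_le (A B : Matrix m m ℂ) :
    (pinching A B).rank ≤ (eigs A).card * B.rank := by
  unfold pinching
  have key : ∀ s : Finset ℝ,
      (∑ a ∈ s, eigProj A a * B * eigProj A a).rank ≤ s.card * B.rank := by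
    intro s
    induction s using Finset.induction_on with
    | empty => simp
    | insert a s ha ih =>
      rw [Finset.sum_insert ha, Finset.card_insert_of_notMem ha, add_mul, one_mul, add_comm]
      exact (rank_add_le _ _).trans (add_le_add ih
        ((Matrix.rank_mul_le_left _ _).trans (Matrix.rank_mul_le_right _ _)))
  exact key _

/-- The support projection of a Hermitian matrix. -/
noncomputable def supportProj (M : Matrix m m ℂ) : Matrix m m ℂ :=
  cfc (fun t : ℝ => if t ≠ 0 then (1 : ℝ) else 0) M

theorem isStarProjection_supportProj (M : Matrix m m ℂ) : IsStarProjection (supportProj M) :=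
  isStarProjection_cfc M _

theorem trace_supportProj {M : Matrix m m ℂ} (hM : M.IsHermitian) :
    (supportProj M).trace.re = M.rank := by
  have hM' : IsSelfAdjoint M := hM
  have h := rank_cfc hM id
  rw [cfc_id ℝ M hM'] at h
  rw [h]
  unfold supportProj
  congr 4
  funext t
  simp [ite_not]

theorem mul_supportProj {M : Matrix m m ℂ} (hM : M.IsHermitian) : M * supportProj M = M := by
  have hM' : IsSelfAdjoint M := hM
  unfold supportProj
  nth_rewrite 1 [← cfc_id ℝ M hM']
  rw [cfc_mul_cfc]
  conv_rhs => rw [← cfc_id ℝ M hM']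
  congr 1
  funext t
  by_cases h : t = 0 <;> simp [h]

/-- The support of the pinching of a projection contains the range of that projection: this is
what the pinching inequality `R ≤ v • ℰ(R)` becomes at the level of supports. -/
theorem mul_supportProj_pinching {A R : Matrix m m ℂ} (hA : A.IsHermitian)
    (hR : IsStarProjection R) :
    R * supportProj (pinching A R) = R := by
  have hRpsd : R.PosSemidef := by
    have := Matrix.posSemidef_conjTranspose_mul_self R
    rwa [hR.conjTranspose_eq, hR.isIdempotentElem.eq] at this
  set M := pinching A R with hMdef
  have hM := posSemidef_pinching A hRpsd
  set N := 1 - supportProj M with hN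
  have hNp : IsStarProjection N := (isStarProjection_supportProj M).one_sub
  have hMN : M * N = 0 := by rw [hN, mul_sub, mul_one, mul_supportProj hM.1, sub_self]
  -- The vanishing trace of `N M N` is a sum of squared norms of the `R E_a N`.
  have hterm : ∀ a, ((R * eigProj A a * N).conjTranspose * (R * eigProj A a * N)) =
      N * (eigProj A a * R * eigProj A a) * N := by
    intro a
    rw [Matrix.conjTranspose_mul, Matrix.conjTranspose_mul, hNp.conjTranspose_eq,
      hR.conjTranspose_eq,
      (isStarProjection_eigProj A a).conjTranspose_eq]
    calc _ = N * (eigProj A a * (R * R) * eigProj A a) * N := by simp only [mul_assoc]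
      _ = _ := by rw [hR.isIdempotentElem.eq]
  have hsum : ∑ a ∈ eigs A,
      ((R * eigProj A a * N).conjTranspose * (R * eigProj A a * N)).trace = 0 := by
    simp only [hterm]
    rw [← Matrix.trace_sum, ← Finset.sum_mul, ← Finset.mul_sum]
    change (N * M * N).trace = 0
    rw [mul_assoc, hMN, mul_zero, Matrix.trace_zero]
  have hzero : ∀ a ∈ eigs A, R * eigProj A a * N = 0 := by
    intro a ha
    rw [Finset.sum_eq_zero_iff_of_nonneg
      (fun a _ => (Matrix.posSemidef_conjTranspose_mul_self _).trace_nonneg)] at hsum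
    exact Matrix.trace_conjTranspose_mul_self_eq_zero_iff.mp (hsum a ha)
  have hRN : R * N = 0 := by
    have : R * N = ∑ a ∈ eigs A, R * eigProj A a * N := by
      rw [← Finset.sum_mul, ← Finset.mul_sum, sum_eigProj hA, mul_one]
    rw [this, Finset.sum_eq_zero hzero]
  rw [hN, mul_sub, mul_one, sub_eq_zero] at hRN
  exact hRN.symm

end Pinching

/-! ### The one-shot error bound -/

section OneShot

variable {m : Type*} [Fintype m] [DecidableEq m]

/-- One-shot error bound. The test compared with `{ℰ_S(R) - E S ≤ 0}` in the Neyman–Pearson lemma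
is `1 - Q` with `Q = {S ≤ μ} P`, where `P` is the support projection of the pinched projection
`{R ≥ θ}`. Here `Q` commutes with `S`, so that it does not see the pinching of `R`, and the trace of
`P` is at most that of `{R ≥ θ}` times the number of eigenvalues of `S`. -/
theorem trace_pinching_mul_projNonpos_le {R S : Matrix m m ℂ} (hR : R.PosSemidef)
    (hS : S.PosSemidef) {E μ θ : ℝ} (hE : 0 ≤ E) (hμ : 0 ≤ μ) (hθ : 0 < θ) :
    (pinching S R * projNonpos (pinching S R - E • S)).trace.re ≤
      (R * (1 - cfc (fun t : ℝ => if θ ≤ t then (1 : ℝ) else 0) R)).trace.re +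
      (R * (1 - cfc (fun t : ℝ => if t ≤ μ then (1 : ℝ) else 0) S)).trace.re +
      E * μ * ((eigs S).card * (R.trace.re / θ)) := by
  have hSs : IsSelfAdjoint S := hS.1
  have hRs : IsSelfAdjoint R := hR.1
  set F := cfc (fun t : ℝ => if t ≤ μ then (1 : ℝ) else 0) S with hF
  set G := cfc (fun t : ℝ => if θ ≤ t then (1 : ℝ) else 0) R with hG
  set P := supportProj (pinching S G) with hP
  set T := projNonpos (pinching S R - E • S) with hT
  have hFp : IsStarProjection F := isStarProjection_cfc S _
  have hGp : IsStarProjection G := isStarProjection_cfc R _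
  have hGpsd : G.PosSemidef := posSemidef_cfc fun t _ => by split_ifs <;> norm_num
  have hPp : IsStarProjection P := isStarProjection_supportProj _
  have hMpsd := posSemidef_pinching S hGpsd
  have hSP : Commute S P :=
    (IsSelfAdjoint.commute_cfc (show IsSelfAdjoint (pinching S G) from hMpsd.1)
      (commute_pinching hS.1 G).symm _).symm
  have hFP : Commute F P := IsSelfAdjoint.commute_cfc hSs hSP _
  have hSF : Commute S F := (IsSelfAdjoint.commute_cfc hSs (Commute.refl S) _).symm
  have hQ : IsStarProjection (F * P) := hFp.mul hPp hFP
  have hSQ : Commute S (F * P) := hSF.mul_right hSP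
  have hTp : IsStarProjection T := by rw [hT, projNonpos_eq_cfc]; exact isStarProjection_cfc _ _
  -- The Neyman–Pearson lemma for the pinched operator.
  have hNP : (pinching S R * T).trace.re ≤
      R.trace.re - (R * (F * P)).trace.re + E * (S * (F * P)).trace.re := by
    have hA : (pinching S R - E • S).IsHermitian :=
      (posSemidef_pinching S hR).1.sub ((IsSelfAdjoint.all E).smul hSs)
    have h := hQ.trace_mul_le_projNonpos hA
    have hS0 := hTp.one_sub.trace_mul_nonneg hS
    rw [← hT] at h
    simp only [sub_mul, Matrix.trace_sub, Complex.sub_re, smul_mul_assoc, Matrix.trace_smul,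
      Complex.smul_re, smul_eq_mul] at h
    rw [trace_pinching_mul hS.1 hR hSQ, mul_sub (pinching S R), mul_one, Matrix.trace_sub,
      Complex.sub_re] at h
    have h1 : (pinching S R).trace = R.trace := by
      simpa using trace_pinching_mul hS.1 hR (Commute.one_right S)
    rw [h1] at h
    have := mul_nonneg hE hS0
    linarith
  -- The projections `F` and `P` commute, and `P` dominates `G`.
  have hmiss : R.trace.re - (R * (F * P)).trace.re ≤
      (R * (1 - G)).trace.re + (R * (1 - F)).trace.re := by
    have hFP' : Commute (1 - F) (1 - P) :=
      (Commute.one_left _).sub_left ((Commute.one_right F).sub_right hFP)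
    have h1 := (hFp.one_sub.mul hPp.one_sub hFP').trace_mul_nonneg hR
    have hPG : P * G = G := by
      have h := congrArg Matrix.conjTranspose (mul_supportProj_pinching hS.1 hGp)
      rwa [Matrix.conjTranspose_mul, ← hP, hPp.conjTranspose_eq, hGp.conjTranspose_eq] at h
    have hGP : G * P = G := mul_supportProj_pinching hS.1 hGp
    have h2 : 0 ≤ (R * (P - G)).trace.re := by
      have hp : IsStarProjection (P * (1 - G)) :=
        hPp.mul hGp.one_sub ((Commute.one_right P).sub_right (hPG.trans hGP.symm))
      have := hp.trace_mul_nonneg hR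
      rwa [mul_sub, mul_one, hPG] at this
    have h3 : R * ((1 - F) * (1 - P)) = R - R * F - R * P + R * (F * P) := by noncomm_ring
    rw [h3] at h1
    simp only [mul_sub, mul_one, Matrix.trace_sub, Matrix.trace_add, Complex.sub_re,
      Complex.add_re] at h1 h2 ⊢
    linarith
  -- On the range of `F` the operator `S` is at most `μ`.
  have hsize : (S * (F * P)).trace.re ≤ μ * P.trace.re := by
    have hpsd : (μ • (1 : Matrix m m ℂ) - S * F).PosSemidef := by
      have h : μ • (1 : Matrix m m ℂ) - S * F =
          cfc (fun t : ℝ => μ - t * (if t ≤ μ then (1 : ℝ) else 0)) S := by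
        rw [cfc_sub _ _ S (continuousOn_eigs S _) (continuousOn_eigs S _), cfc_const μ S hSs,
          ← cfc_mul_cfc S (fun t => t), cfc_id' ℝ S hSs, Algebra.algebraMap_eq_smul_one]
      rw [h]
      refine posSemidef_cfc fun t _ => ?_
      split_ifs with h
      · linarith
      · linarith
    have h := hPp.trace_mul_nonneg hpsd
    simp only [sub_mul, Matrix.trace_sub, Complex.sub_re, smul_mul_assoc, Matrix.trace_smul,
      Complex.smul_re, smul_eq_mul, one_mul, mul_assoc] at h
    linarith
  have hrank : P.trace.re ≤ (eigs S).card * (R.trace.re / θ) := by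
    rw [hP, trace_supportProj hMpsd.1]
    have h1 : ((pinching S G).rank : ℝ) ≤ (eigs S).card * G.rank := by
      exact_mod_cast rank_pinching_le S G
    refine h1.trans (mul_le_mul_of_nonneg_left ?_ (Nat.cast_nonneg _))
    rw [hG, rank_cfc hR.1]
    have hpsd : (cfc (fun t : ℝ => t / θ -
        if (if θ ≤ t then (1 : ℝ) else 0) = 0 then (0 : ℝ) else 1) R).PosSemidef := by
      refine posSemidef_cfc fun t ht => ?_
      have ht0 := spectrum_nonneg hR ht
      by_cases h : θ ≤ t
      · simpa [h] using (one_le_div hθ).mpr h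
      · simpa [h] using div_nonneg ht0 hθ.le
    have h2 := (Complex.nonneg_iff.mp hpsd.trace_nonneg).1
    rw [cfc_sub _ _ R (continuousOn_eigs R _) (continuousOn_eigs R _), Matrix.trace_sub,
      Complex.sub_re] at h2
    have h3 : cfc (fun t : ℝ => t / θ) R = θ⁻¹ • R := by
      have : (fun t : ℝ => t / θ) = fun t => θ⁻¹ • t := by
        funext t; rw [smul_eq_mul, div_eq_inv_mul]
      rw [this, cfc_smul _ _ R (continuousOn_eigs R _), cfc_id' ℝ R hRs]
    rw [h3, Matrix.trace_smul, Complex.smul_re, smul_eq_mul, ← div_eq_inv_mul] at h2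
    linarith
  have h1 := mul_le_mul_of_nonneg_left hsize hE
  have h2 := mul_le_mul_of_nonneg_left hrank (mul_nonneg hE hμ)
  nlinarith [hNP, hmiss, h1, h2]

end OneShot

/-! ### Spectra of tensor products -/

section Tensor

variable {d : Type*} [Fintype d] {n : ℕ}

theorem tensorProd_mul (A B : Fin n → Matrix d d ℂ) :
    tensorProd A * tensorProd B = tensorProd fun k => A k * B k := by
  classical
  ext i j
  simp only [tensorProd, Matrix.mul_apply, Matrix.of_apply, Fintype.prod_sum,
    Finset.prod_mul_distrib]

omit [Fintype d] in
theorem conjTranspose_tensorProd (A : Fin n → Matrix d d ℂ) :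
    (tensorProd A).conjTranspose = tensorProd fun k => (A k).conjTranspose := by
  ext i j
  simp [tensorProd, Matrix.conjTranspose_apply]

theorem trace_tensorProd (A : Fin n → Matrix d d ℂ) :
    (tensorProd A).trace = ∏ k, (A k).trace := by
  classical
  simp only [tensorProd, Matrix.trace, Matrix.diag, Matrix.of_apply, Fintype.prod_sum]

theorem posSemidef_tensorProd {A : Fin n → Matrix d d ℂ} (hA : ∀ k, (A k).PosSemidef) :
    (tensorProd A).PosSemidef := by
  classical
  open scoped MatrixOrder in
  have h : ∀ k, ∃ B : Matrix d d ℂ, A k = B.conjTranspose * B := fun k =>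
    CStarAlgebra.nonneg_iff_eq_star_mul_self.mp (hA k).nonneg
  choose B hB using h
  have : tensorProd A = (tensorProd B).conjTranspose * tensorProd B := by
    rw [conjTranspose_tensorProd, tensorProd_mul]
    exact congrArg _ (funext hB)
  rw [this]
  exact Matrix.posSemidef_conjTranspose_mul_self _

omit [Fintype d] in
theorem tensorProd_diagonal [DecidableEq d] (l : Fin n → d → ℂ) :
    tensorProd (fun k => Matrix.diagonal (l k)) =
      Matrix.diagonal fun j : Fin n → d => ∏ k, l k (j k) := by
  ext i j
  simp only [tensorProd, Matrix.of_apply, Matrix.diagonal_apply]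
  by_cases h : i = j
  · subst h; simp
  · obtain ⟨k, hk⟩ := Function.ne_iff.mp h
    rw [if_neg h]
    exact Finset.prod_eq_zero (Finset.mem_univ k) (if_neg hk)

/-- A tensor product of Hermitian matrices is diagonal in the product of their eigenbases. -/
theorem exists_tensorProd_conj_diagonal [DecidableEq d] {A : Fin n → Matrix d d ℂ}
    (hA : ∀ k, (A k).IsHermitian) :
    ∃ W : Matrix (Fin n → d) (Fin n → d) ℂ, W.conjTranspose * W = 1 ∧
      tensorProd A = W * Matrix.diagonal
        (fun j => ((∏ k, (hA k).eigenvalues (j k) : ℝ) : ℂ)) * W.conjTranspose := by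
  choose W hW h using fun k => exists_conj_diagonal (hA k)
  refine ⟨tensorProd W, ?_, ?_⟩
  · rw [conjTranspose_tensorProd, tensorProd_mul]
    simp only [hW]
    have := tensorProd_diagonal (n := n) (fun _ (_ : d) => (1 : ℂ))
    simpa using this
  · have hD := tensorProd_diagonal fun k j => (((hA k).eigenvalues j : ℝ) : ℂ)
    push_cast
    rw [← hD, conjTranspose_tensorProd, tensorProd_mul, tensorProd_mul]
    exact congrArg _ (funext h)

theorem trace_cfc_tensorProd [DecidableEq d] {A : Fin n → Matrix d d ℂ}
    (hA : ∀ k, (A k).IsHermitian) (g : ℝ → ℝ) :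
    (cfc g (tensorProd A)).trace.re = ∑ j : Fin n → d, g (∏ k, (hA k).eigenvalues (j k)) := by
  obtain ⟨W, hW, h⟩ := exists_tensorProd_conj_diagonal hA
  rw [h]
  exact trace_cfc_conj_diagonal hW _ g

theorem eigs_conj_diagonal_subset {m : Type*} [Fintype m] [DecidableEq m] {W : Matrix m m ℂ}
    (hW : W.conjTranspose * W = 1) (l : m → ℝ) :
    eigs (W * Matrix.diagonal (fun i => (l i : ℂ)) * W.conjTranspose) ⊆ Finset.univ.image l := by
  intro t ht
  by_contra hnot
  have hA : IsSelfAdjoint (W * Matrix.diagonal (fun i => (l i : ℂ)) * W.conjTranspose) :=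
    isHermitian_conj_diagonal W l
  have hl : ∀ i, l i ≠ t := fun i hi => hnot (hi ▸ Finset.mem_image_of_mem _ (Finset.mem_univ i))
  -- The spectral projection for a value that is not attained vanishes.
  have h0 : eigProj (W * Matrix.diagonal (fun i => (l i : ℂ)) * W.conjTranspose) t = 0 := by
    unfold eigProj
    rw [cfc_conj_diagonal hW]
    simp [hl]
  unfold eigProj at h0
  have := (cfc_eq_cfc_iff_eqOn hA (continuousOn_eigs _ _) (continuousOn_eigs _ _)).mp
    (h0.trans (cfc_zero ℝ _).symm) (show t ∈ spectrum ℝ _ by simpa [eigs] using ht)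
  simp at this

/-- The number of distinct eigenvalues of a tensor power grows only polynomially: an eigenvalue
is determined by how often each eigenvalue of `A` occurs as a factor of it. -/
theorem card_eigs_tensorPow_le [DecidableEq d] {A : Matrix d d ℂ} (hA : A.IsHermitian) (n : ℕ) :
    (eigs (tensorPow n A)).card ≤ (n + 1) ^ Fintype.card d := by
  obtain ⟨W, hW, h⟩ := exists_tensorProd_conj_diagonal (n := n) (fun _ => hA)
  have hsub := eigs_conj_diagonal_subset hW
    (fun j : Fin n → d => ∏ k, hA.eigenvalues (j k))
  rw [← h] at hsub
  let φ : (d → Fin (n + 1)) → ℝ := fun c => ∏ i, hA.eigenvalues i ^ (c i : ℕ)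
  have hφ : Finset.univ.image (fun j : Fin n → d => ∏ k, hA.eigenvalues (j k)) ⊆
      Finset.univ.image φ := by
    intro t ht
    obtain ⟨j, -, rfl⟩ := Finset.mem_image.mp ht
    refine Finset.mem_image.mpr ⟨fun i => ⟨(Finset.univ.filter fun k => j k = i).card,
      Nat.lt_succ_of_le ((Finset.card_le_univ _).trans_eq (Fintype.card_fin n))⟩,
      Finset.mem_univ _, ?_⟩
    simp only [φ]
    rw [← Finset.prod_fiberwise Finset.univ j]
    refine Finset.prod_congr rfl fun i _ => ?_
    rw [Finset.prod_congr rfl (g := fun _ => hA.eigenvalues i), Finset.prod_const]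
    intro k hk
    rw [(Finset.mem_filter.mp hk).2]
  calc _ ≤ (Finset.univ.image φ).card := Finset.card_le_card (hsub.trans hφ)
    _ ≤ _ := Finset.card_image_le
    _ = _ := by simp

omit [Fintype d] in
theorem sum_prod_smul_tensorProd {X : Type*} [Fintype X] (p : X → ℝ) (ρ : X → Matrix d d ℂ)
    (n : ℕ) :
    ∑ x : Fin n → X, (∏ i, p (x i)) • tensorProd (fun i => ρ (x i)) =
      tensorPow n (mixture p ρ) := by
  classical
  ext i j
  simp only [tensorPow, tensorProd, mixture, Matrix.sum_apply, Matrix.smul_apply, Matrix.of_apply,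
    Fintype.prod_sum, Complex.real_smul, Finset.prod_mul_distrib]
  simp

end Tensor

/-! ### A Chernoff bound -/

/-- A Chernoff bound, as a weak law of large numbers for a finitely supported distribution: the
empirical mean of `f` exceeds a number above its expectation with vanishing probability. -/
theorem tendsto_sum_large_deviation {K : Type*} [Fintype K] {w f : K → ℝ} (hw : ∀ k, 0 ≤ w k)
    (hw1 : ∑ k, w k = 1) {c : ℝ} (hc : ∑ k, w k * f k < c) :
    Tendsto (fun n : ℕ => ∑ k : Fin n → K,
      if n * c ≤ ∑ i, f (k i) then ∏ i, w (k i) else 0) atTop (𝓝 0) := by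
  classical
  let g : ℝ → ℝ := fun s => ∑ k, w k * Real.exp (s * (f k - c))
  have hg0 : g 0 = 1 := by simp [g, hw1]
  have hg' : HasDerivAt g (∑ k, w k * (f k - c)) 0 := by
    refine HasDerivAt.fun_sum fun k _ => ?_
    have := (((hasDerivAt_id (0 : ℝ)).mul_const (f k - c)).exp).const_mul (w k)
    simpa using this
  have hneg : ∑ k, w k * (f k - c) < 0 := by
    simp only [mul_sub, Finset.sum_sub_distrib, ← Finset.sum_mul, hw1, one_mul]
    linarith
  -- The moment generating function has value `1` and negative derivative at `0`.
  obtain ⟨s, hs, hgs⟩ : ∃ s, 0 < s ∧ g s < 1 := by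
    have h1 := hg'.tendsto_slope_zero_right.eventually (gt_mem_nhds hneg)
    obtain ⟨s, hs1, hs⟩ := (h1.and self_mem_nhdsWithin).exists
    refine ⟨s, hs, ?_⟩
    rw [zero_add, hg0, smul_eq_mul] at hs1
    have := neg_of_mul_neg_right hs1 (inv_pos.mpr hs).le
    linarith
  have hgnn : 0 ≤ g s := Finset.sum_nonneg fun k _ => mul_nonneg (hw k) (Real.exp_pos _).le
  refine squeeze_zero (fun n => Finset.sum_nonneg fun k _ => ?_) (fun n => ?_)
    (tendsto_pow_atTop_nhds_zero_of_lt_one hgnn hgs)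
  · split_ifs
    · exact Finset.prod_nonneg fun i _ => hw _
    · exact le_rfl
  · have : g s ^ n = ∑ k : Fin n → K, ∏ i, (w (k i) * Real.exp (s * (f (k i) - c))) := by
      have h := Fintype.prod_sum fun (_ : Fin n) k => w k * Real.exp (s * (f k - c))
      rw [← h, Finset.prod_const, Finset.card_univ, Fintype.card_fin]
    rw [this]
    refine Finset.sum_le_sum fun k _ => ?_
    rw [Finset.prod_mul_distrib, ← Real.exp_sum, ← Finset.mul_sum, Finset.sum_sub_distrib]
    have hnn : 0 ≤ ∏ i, w (k i) := Finset.prod_nonneg fun i _ => hw _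
    split_ifs with h
    · refine le_mul_of_one_le_right hnn (Real.one_le_exp (mul_nonneg hs.le ?_))
      simpa using h
    · exact mul_nonneg hnn (Real.exp_pos _).le

/-! ### Typicality -/

section Typicality

variable {d : Type*} [Fintype d] [DecidableEq d]

theorem mul_one_sub_cfc {A : Matrix d d ℂ} (hA : A.IsHermitian) (g : ℝ → ℝ) :
    A * (1 - cfc g A) = cfc (fun t => t * (1 - g t)) A := by
  have hA' : IsSelfAdjoint A := hA
  rw [← cfc_mul_cfc A (fun t => t), cfc_id' ℝ A hA',
    cfc_sub _ _ A (continuousOn_eigs A _) (continuousOn_eigs A _), cfc_const_one ℝ A hA']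

theorem entropy_eq {A : Matrix d d ℂ} (hA : A.IsHermitian) :
    entropy A = -∑ i, hA.eigenvalues i * Real.log (hA.eigenvalues i) := by
  have hA' : IsSelfAdjoint A := hA
  obtain ⟨W, hW, h⟩ := exists_conj_diagonal hA
  have h1 : A * cfc Real.log A = cfc (fun t => t * Real.log t) A := by
    rw [← cfc_mul_cfc A (fun t => t), cfc_id' ℝ A hA']
  unfold entropy
  rw [h1]
  conv_lhs => rw [h]
  rw [trace_cfc_conj_diagonal hW]

theorem IsDensity.sum_eigenvalues {A : Matrix d d ℂ} (hA : IsDensity A) :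
    ∑ i, hA.posSemidef.1.eigenvalues i = 1 := by
  have h := hA.posSemidef.1.trace_eq_sum_eigenvalues
  rw [hA.trace_eq_one] at h
  have h' := congrArg Complex.re h
  rw [Complex.re_sum] at h'
  simpa using h'.symm

/-- The state `σ^{⊗ n}` is concentrated on the spectral subspace of the eigenvalues at most
`e^{-nc}`, for `c` below the entropy of `σ`. -/
theorem tendsto_trace_tensorPow_large {σ : Matrix d d ℂ} (hσ : IsDensity σ) {c : ℝ}
    (hc : c < entropy σ) :
    Tendsto (fun n : ℕ => (tensorPow n σ * (1 - cfc (fun t : ℝ =>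
      if t ≤ Real.exp (-(n * c)) then (1 : ℝ) else 0) (tensorPow n σ))).trace.re)
      atTop (𝓝 0) := by
  set s := hσ.posSemidef.1.eigenvalues with hs
  have hs0 : ∀ i, 0 ≤ s i := hσ.posSemidef.eigenvalues_nonneg
  have hlim := tendsto_sum_large_deviation (w := s) (f := fun i => Real.log (s i)) (c := -c) hs0
    hσ.sum_eigenvalues (by rw [entropy_eq hσ.posSemidef.1] at hc; linarith)
  have heq : ∀ n : ℕ, (tensorPow n σ * (1 - cfc (fun t : ℝ =>
      if t ≤ Real.exp (-(n * c)) then (1 : ℝ) else 0) (tensorPow n σ))).trace.re =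
      ∑ j : Fin n → d, (∏ k, s (j k)) *
        (1 - if (∏ k, s (j k)) ≤ Real.exp (-(n * c)) then (1 : ℝ) else 0) := by
    intro n
    unfold tensorPow
    rw [mul_one_sub_cfc (posSemidef_tensorProd fun _ => hσ.posSemidef).1]
    exact trace_cfc_tensorProd (fun _ => hσ.posSemidef.1) _
  simp only [heq]
  refine squeeze_zero (fun n => Finset.sum_nonneg fun j _ => ?_)
    (fun n => Finset.sum_le_sum fun j _ => ?_) hlim
  · refine mul_nonneg (Finset.prod_nonneg fun _ _ => hs0 _) ?_
    split_ifs <;> norm_num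
  · have hl0 : 0 ≤ ∏ k, s (j k) := Finset.prod_nonneg fun _ _ => hs0 _
    by_cases h : (∏ k, s (j k)) ≤ Real.exp (-(n * c))
    · rw [if_pos h, sub_self, mul_zero]
      split_ifs
      exacts [hl0, le_rfl]
    · rw [not_le] at h
      have hne : ∀ k ∈ Finset.univ, s (j k) ≠ 0 :=
        Finset.prod_ne_zero_iff.mp ((Real.exp_pos _).trans h).ne'
      have hlog : n * -c ≤ ∑ k, Real.log (s (j k)) := by
        rw [← Real.log_prod hne, mul_neg]
        exact (Real.le_log_iff_exp_le ((Real.exp_pos _).trans h)).mpr h.le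
      rw [if_neg h.not_ge, if_pos hlog]
      simp

/-- The states `ρ_{x^n}` are, on average over `x^n`, concentrated on their spectral subspaces of
the eigenvalues at least `e^{-nc}`, for `c` above the conditional entropy. -/
theorem tendsto_sum_trace_tensorProd_small {X : Type*} [Fintype X] {p : X → ℝ}
    (hp : p ∈ stdSimplex ℝ X) {ρ : X → Matrix d d ℂ} (hρ : ∀ x, IsDensity (ρ x)) {c : ℝ}
    (hc : ∑ x, p x * entropy (ρ x) < c) :
    Tendsto (fun n : ℕ => ∑ x : Fin n → X, (∏ i, p (x i)) *
      ((tensorProd fun i => ρ (x i)) * (1 - cfc (fun t : ℝ =>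
        if Real.exp (-(n * c)) ≤ t then (1 : ℝ) else 0)
        (tensorProd fun i => ρ (x i)))).trace.re) atTop (𝓝 0) := by
  have hH : ∀ x, (ρ x).IsHermitian := fun x => (hρ x).posSemidef.1
  set r : X → d → ℝ := fun x => (hH x).eigenvalues with hr
  have hr0 : ∀ x i, 0 ≤ r x i := fun x => (hρ x).posSemidef.eigenvalues_nonneg
  have hr1 : ∀ x, ∑ i, r x i = 1 := fun x => (hρ x).sum_eigenvalues
  have hlim := tendsto_sum_large_deviation (K := X × d) (w := fun k => p k.1 * r k.1 k.2)
    (f := fun k => -Real.log (r k.1 k.2)) (c := c)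
    (fun k => mul_nonneg (hp.1 _) (hr0 _ _))
    (by rw [Fintype.sum_prod_type]; simp [← Finset.mul_sum, hr1, hp.2])
    (by
      refine lt_of_eq_of_lt ?_ hc
      rw [Fintype.sum_prod_type]
      refine Finset.sum_congr rfl fun x _ => ?_
      rw [entropy_eq (hH x), ← Finset.sum_neg_distrib, Finset.mul_sum]
      exact Finset.sum_congr rfl fun i _ => by ring)
  have heq : ∀ (n : ℕ) (x : Fin n → X), ((tensorProd fun i => ρ (x i)) * (1 - cfc (fun t : ℝ =>
        if Real.exp (-(n * c)) ≤ t then (1 : ℝ) else 0)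
        (tensorProd fun i => ρ (x i)))).trace.re =
      ∑ j : Fin n → d, (∏ k, r (x k) (j k)) *
        (1 - if Real.exp (-(n * c)) ≤ (∏ k, r (x k) (j k)) then (1 : ℝ) else 0) := by
    intro n x
    rw [mul_one_sub_cfc (posSemidef_tensorProd fun i => (hρ (x i)).posSemidef).1]
    exact trace_cfc_tensorProd (fun i => hH (x i)) _
  simp only [heq]
  have hl0 : ∀ (n : ℕ) (x : Fin n → X) (j : Fin n → d), 0 ≤ ∏ k, r (x k) (j k) :=
    fun n x j => Finset.prod_nonneg fun _ _ => hr0 _ _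
  have hp0 : ∀ (n : ℕ) (x : Fin n → X), 0 ≤ ∏ i, p (x i) :=
    fun n x => Finset.prod_nonneg fun _ _ => hp.1 _
  refine squeeze_zero (fun n => Finset.sum_nonneg fun x _ => mul_nonneg (hp0 n x)
    (Finset.sum_nonneg fun j _ => mul_nonneg (hl0 n x j) ?_)) (fun n => ?_) hlim
  · split_ifs <;> norm_num
  · rw [← (Equiv.arrowProdEquivProdArrow (Fin n) (fun _ => X) (fun _ => d)).symm.sum_comp,
      Fintype.sum_prod_type]
    refine Finset.sum_le_sum fun x _ => ?_
    rw [Finset.mul_sum]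
    refine Finset.sum_le_sum fun j _ => ?_
    simp only [Equiv.arrowProdEquivProdArrow, Equiv.coe_fn_symm_mk, Finset.prod_mul_distrib]
    have hnn : (0 : ℝ) ≤ if n * c ≤ ∑ i, -Real.log (r (x i) (j i)) then
        (∏ i, p (x i)) * ∏ i, r (x i) (j i) else 0 := by
      split_ifs
      exacts [mul_nonneg (hp0 n x) (hl0 n x j), le_rfl]
    by_cases h : Real.exp (-(n * c)) ≤ ∏ k, r (x k) (j k)
    · rw [if_pos h, sub_self, mul_zero, mul_zero]
      exact hnn
    · rcases (hl0 n x j).eq_or_lt with h0 | h0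
      · rw [← h0, zero_mul, mul_zero, ite_self]
      · have hne : ∀ k ∈ Finset.univ, r (x k) (j k) ≠ 0 := Finset.prod_ne_zero_iff.mp h0.ne'
        have hlog : n * c ≤ ∑ k, -Real.log (r (x k) (j k)) := by
          rw [Finset.sum_neg_distrib, ← Real.log_prod hne, le_neg]
          exact (Real.log_le_iff_le_exp h0).mpr (not_le.mp h).le
        rw [if_neg h, if_pos hlog]
        simp

end Typicality

theorem isDensity_mixture {X d : Type*} [Fintype X] [Fintype d] {p : X → ℝ}
    (hp : p ∈ stdSimplex ℝ X) {ρ : X → Matrix d d ℂ} (hρ : ∀ x, IsDensity (ρ x)) :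
    IsDensity (mixture p ρ) := by
  constructor
  · refine Matrix.posSemidef_sum _ fun x _ => ?_
    exact (hρ x).posSemidef.smul (hp.1 x)
  · unfold mixture
    simp only [Matrix.trace_sum, Matrix.trace_smul, (hρ _).trace_eq_one]
    rw [← Finset.sum_smul, hp.2, one_smul]

theorem tendsto_succ_pow_mul_exp_neg (k : ℕ) {ε : ℝ} (hε : 0 < ε) :
    Tendsto (fun n : ℕ => ((n : ℝ) + 1) ^ k * Real.exp (-(n * ε))) atTop (𝓝 0) := by
  have hlt : Real.exp (-ε) < 1 := by simpa using hε
  have h := (tendsto_pow_const_mul_const_pow_of_lt_one k (Real.exp_pos (-ε)).le hlt).comp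
    (tendsto_add_atTop_nat 1)
  have h2 := h.const_mul (Real.exp ε)
  rw [mul_zero] at h2
  refine h2.congr fun n => ?_
  simp only [Function.comp]
  rw [← Real.exp_nat_mul, mul_left_comm, ← Real.exp_add]
  push_cast
  congr 2
  ring

end QChannel

theorem mainTheorem4 {X d : Type*} [Fintype X] [Fintype d] [DecidableEq d]
    (ρ : X → Matrix d d ℂ) (hρ : ∀ x, QChannel.IsDensity (ρ x))
    (p : X → ℝ) (hp : p ∈ stdSimplex ℝ X)
    (a : ℝ) (ha : a < QChannel.mutualInfo p ρ) :
    Tendsto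
      (fun n : ℕ =>
        ∑ x : Fin n → X, (∏ i, p (x i)) *
          (Matrix.trace
            (QChannel.pinching (QChannel.tensorPow n (QChannel.mixture p ρ))
                (QChannel.tensorProd fun i => ρ (x i)) *
              QChannel.projNonpos
                (QChannel.pinching (QChannel.tensorPow n (QChannel.mixture p ρ))
                    (QChannel.tensorProd fun i => ρ (x i)) -
                  Real.exp (n * a) • QChannel.tensorPow n (QChannel.mixture p ρ)))).re)
      atTop (𝓝 0) := by
  open QChannel in
  classical
  set σ := mixture p ρ with hσdef
  have hσ : IsDensity σ := isDensity_mixture hp hρ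
  set h := ∑ x, p x * entropy (ρ x) with hh
  -- The gap `I(p) - a` is shared between the two typicality thresholds and the remaining rate.
  obtain ⟨ε, hε, hεa⟩ : ∃ ε : ℝ, 0 < ε ∧ a + 3 * ε = entropy σ - h :=
    ⟨(entropy σ - h - a) / 3, by
      have : a < entropy σ - h := ha
      linarith, by ring⟩
  have hR : ∀ (n : ℕ) (x : Fin n → X), (tensorProd fun i => ρ (x i)).PosSemidef :=
    fun n x => posSemidef_tensorProd fun i => (hρ (x i)).posSemidef
  have hS : ∀ n : ℕ, (tensorPow n σ).PosSemidef :=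
    fun n => posSemidef_tensorProd fun _ => hσ.posSemidef
  have hp0 : ∀ (n : ℕ) (x : Fin n → X), 0 ≤ ∏ i, p (x i) :=
    fun n x => Finset.prod_nonneg fun _ _ => hp.1 _
  have hp1 : ∀ n : ℕ, ∑ x : Fin n → X, ∏ i, p (x i) = 1 := fun n => by
    have := Fintype.prod_sum fun (_ : Fin n) x => p x
    rw [← this, hp.2, Finset.prod_const_one]
  have hlim := ((tendsto_sum_trace_tensorProd_small hp hρ
    (show h < h + ε by linarith)).add (tendsto_trace_tensorPow_large hσ
    (show entropy σ - ε < entropy σ by linarith))).add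
    (tendsto_succ_pow_mul_exp_neg (Fintype.card d) hε)
  simp only [add_zero] at hlim
  refine squeeze_zero (fun n => Finset.sum_nonneg fun x _ => mul_nonneg (hp0 n x) ?_)
    (fun n => ?_) hlim
  · rw [projNonpos_eq_cfc]
    exact (isStarProjection_cfc _ _).trace_mul_nonneg (posSemidef_pinching _ (hR n x))
  set F := cfc (fun t : ℝ => if t ≤ Real.exp (-(n * (entropy σ - ε))) then (1 : ℝ) else 0)
    (tensorPow n σ) with hF
  -- Averaging over `x^n` turns `ρ_{x^n}` into `σ^{⊗ n}`.
  have hmix : (tensorPow n σ * (1 - F)).trace.re =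
      ∑ x : Fin n → X, (∏ i, p (x i)) *
        ((tensorProd fun i => ρ (x i)) * (1 - F)).trace.re := by
    rw [hσdef, ← sum_prod_smul_tensorProd, Finset.sum_mul, Matrix.trace_sum, Complex.re_sum]
    simp only [smul_mul_assoc, Matrix.trace_smul, Complex.smul_re, smul_eq_mul]
  have hcard : ((eigs (tensorPow n σ)).card : ℝ) ≤ ((n : ℝ) + 1) ^ Fintype.card d := by
    exact_mod_cast card_eigs_tensorPow_le hσ.posSemidef.1 n
  have hsplit : ((n : ℝ) + 1) ^ Fintype.card d * Real.exp (-(n * ε)) =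
      ∑ x : Fin n → X, (∏ i, p (x i)) *
        (((n : ℝ) + 1) ^ Fintype.card d * Real.exp (-(n * ε))) := by
    rw [← Finset.sum_mul, hp1, one_mul]
  rw [hmix, hsplit, ← Finset.sum_add_distrib, ← Finset.sum_add_distrib]
  refine Finset.sum_le_sum fun x _ => ?_
  rw [← mul_add, ← mul_add]
  refine mul_le_mul_of_nonneg_left ?_ (hp0 n x)
  refine (trace_pinching_mul_projNonpos_le (hR n x) (hS n) (Real.exp_pos _).le
    (Real.exp_pos (-(n * (entropy σ - ε)))).le (Real.exp_pos (-(n * (h + ε))))).trans ?_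
  refine add_le_add le_rfl ?_
  have htr : (tensorProd fun i => ρ (x i)).trace.re = 1 := by
    rw [trace_tensorProd]
    simp [(hρ _).trace_eq_one]
  have hexp : Real.exp (n * a) * Real.exp (-(n * (entropy σ - ε))) *
      (1 / Real.exp (-(n * (h + ε)))) = Real.exp (-(n * ε)) := by
    rw [one_div, ← Real.exp_neg, ← Real.exp_add, ← Real.exp_add]
    congr 1
    linear_combination (n : ℝ) * hεa
  rw [htr, mul_left_comm, hexp]
  exact mul_le_mul_of_nonneg_right hcard (Real.exp_pos _).le
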